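/- **Partial quantum search.** Let $K\ge 1$ and let $N$ be a multiple of $K$. A database is a function $f:R\to\{0,1\}$ on a set $R$ of $N$ addresses with $f(t)=1$ for exactly one address $t\in R$; $R$ is divided into $K$ blocks of $N/K$ addresses each, i.e. an address is a pair $(y,z)$ with $y\in[K]$ and $z\in[N/K]$. *Partial search* asks for the block $y_t$ of $t=(y_t,z_t)$. A quantum algorithm making $T$ queries acts on an address register, a qubit and a finite-dimensional workspace; it starts in a fixed basis state, applies $U_0,O_f,U_1,O_f,\dots,O_f,U_T$, where $O_f|x\rangle|b\rangle|w\rangle=|x\rangle|b\oplus f(x)\rangle|w\rangle$ and the unitaries $U_i$ do not depend on $f$, measures in the computational basis and computes its answer from the outcome. Its success probability is at least $p$ if for every database it answers $y_t$ with probability at least $p$. **Upper bound.** There are constants $c_K>0$ $(K=1,2,\dots)$, with $c_K\ge 0.42/\sqrt K$ for all sufficiently large $K$, and absolute constants $C$ and $D$, such that for every $K\ge1$ and every sufficiently large multiple $N$ of $K$ (how large may depend on $K$) there is a quantum algorithm for partial search that makes at most $\frac{\pi}{4}(1-c_K)\sqrt N$ queries and has success probability at least $1-C N^{-1/2}$,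 and there is a quantum algorithm for partial search that makes at most $D$ queries more than this one and always returns the correct answer. **Lower bound.** Fix $K\ge1$ and real numbers $\alpha_K$ and $C$. Suppose that for all sufficiently large multiples $N$ of $K$ there is a quantum algorithm for partial search that makes at most $\alpha_K\sqrt N$ queries and has success probability at least $1-C N^{-1/4}$. Then $$\alpha_K\ \ge\ \frac{\pi}{4}\left(1-\frac1{\sqrt K}\right).$$ -/

import Mathlib

open Real Filter Matrix

/-- A basis state `|x⟩|b⟩|w⟩`: an address `x`, the answer qubit `b`, and a workspace of
dimension `W`. -/
abbrev QBasis (X : Type) (W : ℕ) : Type := X × Bool × Fin W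

/-- The action of the oracle unitary `|x⟩|b⟩|w⟩ ↦ |x⟩|b ⊕ f x⟩|w⟩` on amplitude vectors.
(It permutes the basis by an involution, so the new amplitude at `(x, b, w)` is the old one at
`(x, b ⊕ f x, w)`.) -/
def oracle {X : Type} {W : ℕ} (f : X → Bool) (ψ : QBasis X W → ℂ) : QBasis X W → ℂ :=
  fun i => ψ (i.1, xor i.2.1 (f i.1), i.2.2)

/-- A quantum query algorithm on databases `f : X → Bool`, with answers in `Y`.  It starts in a
computational basis state, alternates arbitrary unitaries, which do not depend on `f`, with
`queries` applications of the oracle, measures all registers in the computational basis at the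
end, and computes its answer from the measured basis state. -/
structure QueryAlgorithm (X Y : Type) [Fintype X] [DecidableEq X] where
  /-- dimension of the workspace -/
  work : ℕ
  /-- number of oracle queries -/
  queries : ℕ
  /-- initial basis state -/
  init : QBasis X work
  /-- `gate 0` is applied before the first query, `gate t` right after the `t`-th query; only
  `gate 0, …, gate queries` are used -/
  gate : ℕ → Matrix.unitaryGroup (QBasis X work) ℂ
  /-- the answer read off from the measured basis state -/
  output : QBasis X work → Y

namespace QueryAlgorithm

variable {X Y : Type} [Fintype X] [DecidableEq X]

/-- The state after `t` queries to the database `f` and the unitary that follows them. -/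
noncomputable def state (A : QueryAlgorithm X Y) (f : X → Bool) : ℕ → QBasis X A.work → ℂ
  | 0 => (A.gate 0 : Matrix _ _ ℂ) *ᵥ Pi.single A.init 1
  | t + 1 => (A.gate (t + 1) : Matrix _ _ ℂ) *ᵥ oracle f (A.state f t)

/-- The probability that the algorithm, run on the database `f`, answers `y`. -/
noncomputable def prob [DecidableEq Y] (A : QueryAlgorithm X Y) (f : X → Bool) (y : Y) : ℝ :=
  ∑ i with A.output i = y, ‖A.state f A.queries i‖ ^ 2

end QueryAlgorithm

/-- A quantum query algorithm for partial search in a database of `N = K * m` items divided into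
`K` blocks of size `m`: an address is a pair `(y, z)`, with `y` the block and `z` the position in
the block, and an answer is a block. -/
abbrev PartialSearchAlgorithm (K m : ℕ) : Type := QueryAlgorithm (Fin K × Fin m) (Fin K)

/-- On every database with a unique marked address `t`, the algorithm answers the block of `t`
with probability at least `p`.  (For `p = 1`: it is always correct.) -/
def PartialSearchAlgorithm.SucceedsWithProb {K m : ℕ} (A : PartialSearchAlgorithm K m) (p : ℝ) :
    Prop :=
  ∀ (f : Fin K × Fin m → Bool) (t : Fin K × Fin m), (∀ x, f x = true ↔ x = t) →
    p ≤ A.prob f t.1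

/-! Lower bound: compare the run on the empty database with the runs on the `N` databases marking
one address `x`. Unitaries preserve angles, so by the triangle inequality two runs separate only at
queries, each adding at most `2 arcsin √p_x`, where `p_x` is the weight of `x` in the empty run.
Since the `p_x` sum to 1, a query adds at most `2(√N + 1)` over all `x` (`sum_arcsin_sqrt_le`). At
the end, if the empty run answers block `y` with probability `q_y`, the angle for `x` in block `y`
is at least `π/2 (1 - √q_y - √ε)`. The `q_y` sum to 1, so `∑ √q_y ≤ √K`, and the angles total at
least `π/2 · N (1 - 1/√K - √ε)`. Comparing the totals bounds the number of queries
(`QueryAlgorithm.sum_label_le_queries`).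

Upper bound: run Grover's iteration on the whole database, stopping at an angle `δ` short of the
target. Then iterate inside all blocks in parallel; this changes only the target block, which
overshoots by an angle about `Δ` until the rest of it has negative amplitude. A final inversion
about the global average then annihilates all other blocks, provided `leakage` vanishes. Iteration
counts are integers, so exactness needs a continuous parameter: the answer qubit is tilted to `cos η
|-⟩ + sin η |+⟩`, and the oracle sees only the `|-⟩` part. At `η = π/2` nothing rotates and the
leakage is positive; for suitable `δ`, `Δ` it is negative at `η = 0` for large blocks
(`tendsto_leakage`). The intermediate value theorem supplies a zero.

With `δ = x/√K` the saving is `(2/π)(x - Δ)/√K`. For large `K` the constraint is nearly `x < 2 sin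
Δ`, and `2 sin Δ - Δ` is largest at `Δ = π/3`. -/

/-- The real inner product of two amplitude vectors. -/
noncomputable abbrev ampInner {ι : Type*} [Fintype ι] (ψ φ : ι → ℂ) : ℝ :=
  inner ℝ (WithLp.toLp 2 ψ : EuclideanSpace ℂ ι) (WithLp.toLp 2 φ)

/-- The angle between two amplitude vectors, seen as vectors of a real Euclidean space. -/
noncomputable abbrev ampAngle {ι : Type*} [Fintype ι] (ψ φ : ι → ℂ) : ℝ :=
  InnerProductGeometry.angle (WithLp.toLp 2 ψ : EuclideanSpace ℂ ι) (WithLp.toLp 2 φ)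

/-! ### Inner products and angles of amplitude vectors -/

section Amplitudes

variable {ι : Type*} [Fintype ι]

lemma ampInner_eq_sum (ψ φ : ι → ℂ) : ampInner ψ φ = ∑ i, inner ℝ (ψ i) (φ i) := by
  simp [ampInner, PiLp.inner_apply]

lemma ampInner_eq_re (ψ φ : ι → ℂ) : ampInner ψ φ = (star ψ ⬝ᵥ φ).re := by
  rw [ampInner_eq_sum, dotProduct, Complex.re_sum]
  refine Finset.sum_congr rfl fun i _ => ?_
  rw [Complex.inner, mul_comm]
  rfl

lemma ampInner_self (ψ : ι → ℂ) : ampInner ψ ψ = ∑ i, ‖ψ i‖ ^ 2 := by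
  rw [ampInner_eq_sum]
  exact Finset.sum_congr rfl fun i _ => real_inner_self_eq_norm_sq _

lemma ampInner_mulVec [DecidableEq ι] (U : Matrix.unitaryGroup ι ℂ) (ψ φ : ι → ℂ) :
    ampInner ((U : Matrix ι ι ℂ) *ᵥ ψ) ((U : Matrix ι ι ℂ) *ᵥ φ) = ampInner ψ φ := by
  rw [ampInner_eq_re, ampInner_eq_re, star_mulVec, dotProduct_mulVec, vecMul_vecMul,
    ← star_eq_conjTranspose, Matrix.UnitaryGroup.star_mul_self, vecMul_one]

/-- Lets gates and oracle calls applied to both vectors be cancelled inside an angle. -/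
lemma ampAngle_congr {κ : Type*} [Fintype κ] {ψ φ : ι → ℂ} {ψ' φ' : κ → ℂ}
    (h₁ : ampInner ψ φ = ampInner ψ' φ') (h₂ : ampInner ψ ψ = ampInner ψ' ψ')
    (h₃ : ampInner φ φ = ampInner φ' φ') : ampAngle ψ φ = ampAngle ψ' φ' := by
  unfold ampAngle InnerProductGeometry.angle
  simp only [ampInner] at h₁ h₂ h₃
  rw [norm_eq_sqrt_real_inner, norm_eq_sqrt_real_inner (WithLp.toLp 2 φ),
    norm_eq_sqrt_real_inner (WithLp.toLp 2 ψ'), norm_eq_sqrt_real_inner (WithLp.toLp 2 φ'),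
    h₁, h₂, h₃]

lemma ampAngle_eq_arccos {ψ φ : ι → ℂ} (h₁ : ampInner ψ ψ = 1) (h₂ : ampInner φ φ = 1) :
    ampAngle ψ φ = arccos (ampInner ψ φ) := by
  unfold ampAngle InnerProductGeometry.angle
  simp only [ampInner] at h₁ h₂
  rw [norm_eq_sqrt_real_inner, norm_eq_sqrt_real_inner (WithLp.toLp 2 φ), h₁, h₂]
  simp

end Amplitudes

section Oracle

variable {X : Type} {W : ℕ}

/-- The permutation of basis states underlying the oracle. -/
def oracleEquiv (W : ℕ) (f : X → Bool) : QBasis X W ≃ QBasis X W where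
  toFun i := (i.1, xor i.2.1 (f i.1), i.2.2)
  invFun i := (i.1, xor i.2.1 (f i.1), i.2.2)
  left_inv i := by simp
  right_inv i := by simp

lemma oracle_apply (f : X → Bool) (ψ : QBasis X W → ℂ) (i : QBasis X W) :
    oracle f ψ i = ψ (oracleEquiv W f i) := rfl

lemma oracle_const_false (ψ : QBasis X W → ℂ) : oracle (fun _ => false) ψ = ψ := by
  funext i
  simp [oracle]

lemma ampInner_oracle [Fintype X] (f : X → Bool) (ψ φ : QBasis X W → ℂ) :
    ampInner (oracle f ψ) (oracle f φ) = ampInner ψ φ := by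
  simp only [ampInner_eq_sum, oracle_apply]
  exact (oracleEquiv W f).sum_comp fun i => inner ℝ (ψ i) (φ i)

end Oracle

/-! ### The hybrid argument -/

namespace QueryAlgorithm

variable {X Y : Type} [Fintype X] [DecidableEq X]

lemma ampInner_state_self (A : QueryAlgorithm X Y) (f : X → Bool) (t : ℕ) :
    ampInner (A.state f t) (A.state f t) = 1 := by
  induction t with
  | zero =>
    rw [state, ampInner_mulVec, ampInner_self]
    simp [Pi.single_apply, apply_ite]
  | succ t ih => rw [state, ampInner_mulVec, ampInner_oracle, ih]

lemma sum_norm_sq_state (A : QueryAlgorithm X Y) (f : X → Bool) (t : ℕ) :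
    ∑ i, ‖A.state f t i‖ ^ 2 = 1 := by
  rw [← ampInner_self, ampInner_state_self]

/-- The hybrid argument: the runs on two databases drift apart only at the queries. -/
lemma ampAngle_state_le (A : QueryAlgorithm X Y) (f g : X → Bool) (T : ℕ) :
    ampAngle (A.state f T) (A.state g T) ≤
      ∑ t ∈ Finset.range T, ampAngle (oracle f (A.state f t)) (oracle g (A.state f t)) := by
  induction T with
  | zero =>
    have h : A.state f 0 = A.state g 0 := rfl
    have h0 := ampInner_state_self A g 0
    rw [h, ampAngle_eq_arccos h0 h0, h0]
    simp
  | succ T ih =>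
    rw [Finset.sum_range_succ]
    have h₁ : ampAngle (A.state f (T + 1)) (A.state g (T + 1)) =
        ampAngle (oracle f (A.state f T)) (oracle g (A.state g T)) :=
      ampAngle_congr (by rw [state, state, ampInner_mulVec])
        (by rw [state, ampInner_mulVec]) (by rw [state, ampInner_mulVec])
    have h₂ : ampAngle (oracle g (A.state f T)) (oracle g (A.state g T)) =
        ampAngle (A.state f T) (A.state g T) :=
      ampAngle_congr (ampInner_oracle _ _ _) (ampInner_oracle _ _ _) (ampInner_oracle _ _ _)
    have h₃ : ampAngle (oracle f (A.state f T)) (oracle g (A.state g T)) ≤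
        ampAngle (oracle f (A.state f T)) (oracle g (A.state f T)) +
        ampAngle (oracle g (A.state f T)) (oracle g (A.state g T)) :=
      InnerProductGeometry.angle_le_angle_add_angle _ _ _
    linarith

end QueryAlgorithm

/-! ### Trigonometric estimates -/

section TrigBounds

/-- The error is quadratic so that, at `x = √p`, it sums to 1 over a probability distribution and
leaves the leading constant intact. -/
lemma arcsin_le_add_sq {x : ℝ} (h0 : 0 ≤ x) (h1 : x ≤ 1) : arcsin x ≤ x + x ^ 2 := by
  have hu0 : 0 ≤ arcsin x := arcsin_nonneg.2 h0
  have hs : sin (arcsin x) = x := sin_arcsin (by linarith) h1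
  have h2 : 2 / π * arcsin x ≤ x := by
    simpa [hs] using mul_le_sin hu0 (arcsin_le_pi_div_two x)
  have h3 : arcsin x - arcsin x ^ 3 / 6 ≤ x := by
    rcases hu0.eq_or_lt with h | h
    · rw [← h]; simpa using h0
    · simpa [hs] using (sin_gt_sub_cube h).le
  -- Any constant above `π/2` whose cube is at most 6 serves here: the cubic error `(1.6 x)³/6` is
  -- then below `x²`.
  have hpi : arcsin x ≤ 1.6 * x := by
    have : arcsin x ≤ π / 2 * x := by
      have := mul_le_mul_of_nonneg_left h2 (by positivity : (0 : ℝ) ≤ π / 2)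
      field_simp at this ⊢
      linarith
    nlinarith [pi_lt_d2]
  have h4 : arcsin x ^ 3 ≤ (1.6 * x) ^ 3 := pow_le_pow_left₀ hu0 hpi 3
  nlinarith [mul_nonneg (sq_nonneg x) (sub_nonneg.2 h1), sq_nonneg x]

/-- By Jordan's inequality the graph lies above its chord on `[0, 1]`; beyond 1 the left side is
nonpositive. Being linear, the bound can be summed over addresses. -/
lemma pi_div_two_mul_one_sub_le_arccos {x : ℝ} (h0 : 0 ≤ x) : π / 2 * (1 - x) ≤ arccos x := by
  rcases le_total x 1 with h1 | h1
  · have hs : sin (arcsin x) = x := sin_arcsin (by linarith) h1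
    have h2 : 2 / π * arcsin x ≤ x := by
      simpa [hs] using mul_le_sin (arcsin_nonneg.2 h0) (arcsin_le_pi_div_two x)
    have := mul_le_mul_of_nonneg_left h2 (by positivity : (0 : ℝ) ≤ π / 2)
    rw [arccos]
    field_simp at this ⊢
    linarith
  · have := arccos_nonneg x
    nlinarith [pi_pos]

lemma arccos_one_sub_two_mul {p : ℝ} (h0 : 0 ≤ p) (h1 : p ≤ 1) :
    arccos (1 - 2 * p) = 2 * arcsin √p := by
  have hs : sin (arcsin √p) = √p :=
    sin_arcsin (by linarith [sqrt_nonneg p]) (sqrt_le_one.2 h1)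
  have : 1 - 2 * p = cos (2 * arcsin √p) := by
    rw [cos_two_mul, cos_sq', hs, sq_sqrt h0]; ring
  rw [this, arccos_cos]
  · linarith [arcsin_nonneg.2 (sqrt_nonneg p)]
  · linarith [arcsin_le_pi_div_two √p]

lemma sum_sqrt_le_sqrt_card {ι : Type*} [Fintype ι] {p : ι → ℝ} (h0 : ∀ i, 0 ≤ p i)
    (h1 : ∑ i, p i = 1) : ∑ i, √(p i) ≤ √(Fintype.card ι : ℝ) := by
  apply le_sqrt_of_sq_le
  have := sq_sum_le_card_mul_sum_sq (s := Finset.univ) (f := fun i => √(p i))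
  simpa [sq_sqrt (h0 _), h1] using this

lemma sum_arcsin_sqrt_le {ι : Type*} [Fintype ι] {p : ι → ℝ} (h0 : ∀ i, 0 ≤ p i)
    (h1 : ∑ i, p i = 1) : ∑ i, arcsin √(p i) ≤ √(Fintype.card ι : ℝ) + 1 := by
  calc ∑ i, arcsin √(p i) ≤ ∑ i, (√(p i) + p i) := by
        refine Finset.sum_le_sum fun i _ => ?_
        have hp : p i ≤ 1 := h1 ▸ Finset.single_le_sum (fun j _ => h0 j) (Finset.mem_univ i)
        simpa [sq_sqrt (h0 i)] using arcsin_le_add_sq (sqrt_nonneg (p i)) (sqrt_le_one.2 hp)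
    _ ≤ √(Fintype.card ι : ℝ) + 1 := by
        rw [Finset.sum_add_distrib, h1]
        exact add_le_add_left (sum_sqrt_le_sqrt_card h0 h1) 1

end TrigBounds

/-! ### The lower bound -/

section LowerBound

variable {X Y : Type} [Fintype X] [DecidableEq X]

/-- The database with the single marked address `x`. -/
def markedAt (x : X) : X → Bool := fun x' => decide (x' = x)

/-- The probability of finding the address `x` when the address register is measured. -/
noncomputable def addressWeight {W : ℕ} (ψ : QBasis X W → ℂ) (x : X) : ℝ :=
  ∑ i with i.1 = x, ‖ψ i‖ ^ 2

lemma addressWeight_nonneg {W : ℕ} (ψ : QBasis X W → ℂ) (x : X) : 0 ≤ addressWeight ψ x :=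
  Finset.sum_nonneg fun _ _ => by positivity

lemma sum_addressWeight {W : ℕ} (ψ : QBasis X W → ℂ) :
    ∑ x, addressWeight ψ x = ∑ i, ‖ψ i‖ ^ 2 :=
  Finset.sum_fiberwise _ _ _

lemma addressWeight_oracle {W : ℕ} (f : X → Bool) (ψ : QBasis X W → ℂ) (x : X) :
    addressWeight (oracle f ψ) x = addressWeight ψ x := by
  unfold addressWeight
  rw [Finset.sum_filter, Finset.sum_filter]
  exact (oracleEquiv W f).sum_comp fun i => if i.1 = x then ‖ψ i‖ ^ 2 else 0

lemma one_sub_le_ampInner_oracle {W : ℕ} (ψ : QBasis X W → ℂ) (hψ : ampInner ψ ψ = 1) (x : X) :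
    1 - 2 * addressWeight ψ x ≤ ampInner ψ (oracle (markedAt x) ψ) := by
  -- At the marked address this is `-(‖a‖² + ‖b‖²)/2 ≤ -‖a‖‖b‖`. The weights `3/2` and `1/2` add up
  -- to 2 because the oracle preserves the weight of an address.
  have key : ∀ i, ‖ψ i‖ ^ 2 - ((if i.1 = x then ‖ψ i‖ ^ 2 else 0) * (3 / 2) +
      (if i.1 = x then ‖oracle (markedAt x) ψ i‖ ^ 2 else 0) * (1 / 2)) ≤
      inner ℝ (ψ i) (oracle (markedAt x) ψ i) := by
    intro i
    split_ifs with h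
    · have h₁ := neg_le_of_abs_le (abs_real_inner_le_norm (ψ i) (oracle (markedAt x) ψ i))
      nlinarith [sq_nonneg (‖ψ i‖ - ‖oracle (markedAt x) ψ i‖)]
    · have : oracle (markedAt x) ψ i = ψ i := by simp [oracle, markedAt, h]
      rw [this, real_inner_self_eq_norm_sq]
      simp
  have h := Finset.sum_le_sum fun i (_ : i ∈ Finset.univ) => key i
  rw [Finset.sum_sub_distrib, Finset.sum_add_distrib, ← Finset.sum_mul, ← Finset.sum_mul,
    ← Finset.sum_filter, ← Finset.sum_filter, ← ampInner_eq_sum, ← ampInner_self, hψ] at h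
  have h₂ := addressWeight_oracle (markedAt x) ψ x
  unfold addressWeight at h₂ ⊢
  rw [h₂] at h
  linarith

lemma ampAngle_oracle_le {W : ℕ} (ψ : QBasis X W → ℂ) (hψ : ampInner ψ ψ = 1) (x : X) :
    ampAngle ψ (oracle (markedAt x) ψ) ≤ 2 * arcsin √(addressWeight ψ x) := by
  have h1 : addressWeight ψ x ≤ 1 := by
    rw [← hψ, ampInner_self, ← sum_addressWeight]
    exact Finset.single_le_sum (fun y _ => addressWeight_nonneg ψ y) (Finset.mem_univ x)
  rw [ampAngle_eq_arccos hψ (by rw [ampInner_oracle, hψ]),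
    ← arccos_one_sub_two_mul (addressWeight_nonneg ψ x) h1]
  exact arccos_le_arccos (one_sub_le_ampInner_oracle ψ hψ x)

/-- Two states that give the outcomes in `S` with probabilities `q` and at least `1 - ε` have
inner product at most `√q + √ε`. -/
lemma ampInner_le_sqrt_add_sqrt {ι : Type*} [Fintype ι] [DecidableEq ι] {ψ φ : ι → ℂ}
    (hψ : ampInner ψ ψ = 1) (hφ : ampInner φ φ = 1) (S : Finset ι) {ε : ℝ}
    (h : 1 - ε ≤ ∑ i ∈ S, ‖φ i‖ ^ 2) :
    ampInner ψ φ ≤ √(∑ i ∈ S, ‖ψ i‖ ^ 2) + √ε := by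
  rw [ampInner_self] at hψ hφ
  have cs : ∀ R : Finset ι, ∑ i ∈ R, inner ℝ (ψ i) (φ i) ≤
      √(∑ i ∈ R, ‖ψ i‖ ^ 2) * √(∑ i ∈ R, ‖φ i‖ ^ 2) := fun R =>
    (Finset.sum_le_sum fun i _ => real_inner_le_norm (ψ i) (φ i)).trans
      (Real.sum_mul_le_sqrt_mul_sqrt R _ _)
  have sub : ∀ (χ : ι → ℂ) (R : Finset ι), ∑ i ∈ R, ‖χ i‖ ^ 2 ≤ ∑ i, ‖χ i‖ ^ 2 := fun χ R =>
    Finset.sum_le_sum_of_subset_of_nonneg (Finset.subset_univ R) fun _ _ _ => by positivity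
  have hc : ∑ i ∈ Sᶜ, ‖φ i‖ ^ 2 ≤ ε := by
    have := Finset.sum_add_sum_compl S fun i => ‖φ i‖ ^ 2
    linarith
  rw [ampInner_eq_sum, ← Finset.sum_add_sum_compl S]
  refine add_le_add ((cs S).trans ?_) ((cs Sᶜ).trans ?_)
  · exact mul_le_of_le_one_right (sqrt_nonneg _) (sqrt_le_one.2 (hφ ▸ sub φ S))
  · exact (mul_le_of_le_one_left (sqrt_nonneg _) (sqrt_le_one.2 (hψ ▸ sub ψ Sᶜ))).trans
      (sqrt_le_sqrt hc)

/-- If an algorithm answers `label x` with probability at least `1 - ε` whenever `x` is marked,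
then the angles between its run on the empty database and these runs are large on average, whereas
each query contributes little to them. -/
theorem QueryAlgorithm.sum_label_le_queries [DecidableEq Y] (A : QueryAlgorithm X Y)
    (label : X → Y) {ε : ℝ} (hA : ∀ x, 1 - ε ≤ A.prob (markedAt x) (label x)) :
    ∑ x, π / 2 * (1 - (√(A.prob (fun _ => false) (label x)) + √ε)) ≤
      A.queries * (2 * (√(Fintype.card X : ℝ) + 1)) := by
  set f₀ : X → Bool := fun _ => false
  have lower : ∀ x, π / 2 * (1 - (√(A.prob f₀ (label x)) + √ε)) ≤
      ampAngle (A.state f₀ A.queries) (A.state (markedAt x) A.queries) := by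
    intro x
    rw [ampAngle_eq_arccos (A.ampInner_state_self _ _) (A.ampInner_state_self _ _)]
    refine (pi_div_two_mul_one_sub_le_arccos (by positivity)).trans (arccos_le_arccos ?_)
    exact ampInner_le_sqrt_add_sqrt (A.ampInner_state_self _ _) (A.ampInner_state_self _ _) _ (hA x)
  calc _ ≤ ∑ x, ∑ t ∈ Finset.range A.queries, 2 * arcsin √(addressWeight (A.state f₀ t) x) := by
        refine Finset.sum_le_sum fun x _ => (lower x).trans ?_
        refine (A.ampAngle_state_le f₀ (markedAt x) _).trans (Finset.sum_le_sum fun t _ => ?_)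
        rw [show oracle f₀ (A.state f₀ t) = A.state f₀ t from oracle_const_false _]
        exact ampAngle_oracle_le _ (A.ampInner_state_self _ _) x
    _ = ∑ t ∈ Finset.range A.queries, 2 * ∑ x, arcsin √(addressWeight (A.state f₀ t) x) := by
        rw [Finset.sum_comm]
        simp only [Finset.mul_sum]
    _ ≤ ∑ t ∈ Finset.range A.queries, 2 * (√(Fintype.card X : ℝ) + 1) := by
        refine Finset.sum_le_sum fun t _ => ?_
        gcongr
        exact sum_arcsin_sqrt_le (addressWeight_nonneg _)
          (by rw [sum_addressWeight, A.sum_norm_sq_state])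
    _ = _ := by simp

lemma QueryAlgorithm.sum_prob [Fintype Y] [DecidableEq Y] (A : QueryAlgorithm X Y)
    (f : X → Bool) : ∑ y, A.prob f y = 1 := by
  rw [← A.sum_norm_sq_state f A.queries]
  exact Finset.sum_fiberwise _ _ _

/-- All `m` addresses of a block share one label, and the empty run's answer probabilities sum to 1;
Cauchy–Schwarz on them produces the `√K`. -/
lemma PartialSearchAlgorithm.lower_bound_queries {K m : ℕ} (A : PartialSearchAlgorithm K m)
    {ε : ℝ} (hA : A.SucceedsWithProb (1 - ε)) :
    m * (π / 2 * (K - √(K : ℝ) - K * √ε)) ≤ A.queries * (2 * (√((K * m : ℕ) : ℝ) + 1)) := by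
  have h := A.sum_label_le_queries Prod.fst (ε := ε) fun x => hA _ x fun y => by simp [markedAt]
  have hs := sum_sqrt_le_sqrt_card (p := fun y => A.prob (fun _ => false) y)
    (fun y => Finset.sum_nonneg fun _ _ => by positivity) (A.sum_prob _)
  simp only [Fintype.card_prod, Fintype.card_fin] at h hs
  refine le_trans ?_ h
  rw [Fintype.sum_prod_type]
  simp only [Finset.sum_const, Finset.card_univ, Fintype.card_fin, nsmul_eq_mul]
  rw [← Finset.mul_sum, ← Finset.mul_sum, Finset.sum_sub_distrib, Finset.sum_add_distrib]
  simp only [Finset.sum_const, Finset.card_univ, Fintype.card_fin, nsmul_eq_mul, mul_one]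
  exact mul_le_mul_of_nonneg_left (mul_le_mul_of_nonneg_left (by linarith) (by positivity))
    (by positivity)

theorem PartialSearchAlgorithm.lower_bound {K : ℕ} (hK : 1 ≤ K) (α C : ℝ)
    (h : ∀ᶠ m : ℕ in atTop, ∃ A : PartialSearchAlgorithm K m,
      (A.queries : ℝ) ≤ α * √((K * m : ℕ) : ℝ) ∧
      A.SucceedsWithProb (1 - C * ((K * m : ℕ) : ℝ) ^ (-(1 / 4) : ℝ))) :
    π / 4 * (1 - 1 / √(K : ℝ)) ≤ α := by
  have hN : Tendsto (fun m : ℕ => ((K * m : ℕ) : ℝ)) atTop atTop :=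
    tendsto_natCast_atTop_atTop.comp (tendsto_id.const_mul_atTop' (by omega))
  have hε : Tendsto (fun m : ℕ => √(C * ((K * m : ℕ) : ℝ) ^ (-(1 / 4) : ℝ))) atTop (nhds 0) := by
    have := (((tendsto_rpow_neg_atTop (show (0 : ℝ) < 1 / 4 by norm_num)).comp hN).const_mul C).sqrt
    simpa using this
  have hr : Tendsto (fun m : ℕ => (√((K * m : ℕ) : ℝ))⁻¹) atTop (nhds 0) :=
    (tendsto_sqrt_atTop.comp hN).inv_tendsto_atTop
  have hl : Tendsto (fun m : ℕ => π / 4 * (1 - 1 / √(K : ℝ) -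
      √(C * ((K * m : ℕ) : ℝ) ^ (-(1 / 4) : ℝ)))) atTop (nhds (π / 4 * (1 - 1 / √(K : ℝ)))) := by
    simpa using (hε.const_sub (1 - 1 / √(K : ℝ))).const_mul (π / 4)
  have hu : Tendsto (fun m : ℕ => α * (1 + (√((K * m : ℕ) : ℝ))⁻¹)) atTop (nhds α) := by
    simpa using (hr.const_add 1).const_mul α
  -- What remains is the finite inequality divided by `2N`; only `√ε → 0` is needed of the error.
  refine le_of_tendsto_of_tendsto hl hu ?_
  filter_upwards [h, eventually_ge_atTop 1] with m ⟨A, hq, hs⟩ hm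
  have hb := A.lower_bound_queries hs
  set ε := √(C * ((K * m : ℕ) : ℝ) ^ (-(1 / 4) : ℝ))
  have hK0 : (0 : ℝ) < K := by exact_mod_cast hK
  have hm0 : (0 : ℝ) < m := by exact_mod_cast hm
  have hsK : 0 < √(K : ℝ) := sqrt_pos.2 hK0
  have hKK : √(K : ℝ) * √(K : ℝ) = K := mul_self_sqrt hK0.le
  set r := √((K * m : ℕ) : ℝ) with hrdef
  have hr0 : 0 < r := sqrt_pos.2 (by push_cast; positivity)
  have hrr : r * r = K * m := by rw [hrdef, mul_self_sqrt (by positivity)]; push_cast; rfl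
  have h₁ : (A.queries : ℝ) * (2 * (r + 1)) ≤ α * r * (2 * (r + 1)) := by gcongr
  have h₂ : m * (π / 2 * (K - √(K : ℝ) - K * ε)) =
      2 * (r * r) * (π / 4 * (1 - 1 / √(K : ℝ) - ε)) := by
    rw [hrr]
    field_simp
    linear_combination (-4 : ℝ) * hKK
  have h₃ : α * r * (2 * (r + 1)) = 2 * (r * r) * (α * (1 + r⁻¹)) := by
    field_simp
  exact le_of_mul_le_mul_left (by linarith) (by positivity : 0 < 2 * (r * r))

end LowerBound

/-! ### Gates from real reflections -/

section RealUnitaries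

variable {ι : Type*} [Fintype ι] [DecidableEq ι]

/-- A real orthogonal matrix, as a complex unitary matrix. -/
noncomputable def realUnitary (M : Matrix ι ι ℝ) (h : M * Mᵀ = 1) : Matrix.unitaryGroup ι ℂ :=
  ⟨M.map Complex.ofRealHom, by
    rw [Matrix.mem_unitaryGroup_iff, star_eq_conjTranspose]
    have h₁ : (M.map Complex.ofRealHom)ᴴ = Mᵀ.map Complex.ofRealHom := by
      ext i j
      simp
    rw [h₁, ← Matrix.map_mul, h]
    simp⟩

lemma realUnitary_mulVec (M : Matrix ι ι ℝ) (h : M * Mᵀ = 1) (v : ι → ℝ) :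
    (realUnitary M h : Matrix ι ι ℂ) *ᵥ (fun i => (v i : ℂ)) = fun i => ((M *ᵥ v) i : ℂ) := by
  funext i
  exact (RingHom.map_mulVec Complex.ofRealHom M v i).symm

lemma reflection_mul_transpose {P : Matrix ι ι ℝ} (hs : Pᵀ = P) (hp : P * P = P) :
    ((2 : ℝ) • P - 1) * ((2 : ℝ) • P - 1)ᵀ = 1 := by
  rw [transpose_sub, transpose_smul, hs, transpose_one, sub_mul, mul_sub, smul_mul_smul_comm, hp]
  simp only [mul_one, one_mul]
  rw [← sub_eq_zero]
  module

/-- The reflection `2 P - 1` in the range of an orthogonal projection. -/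
noncomputable def reflectionGate (P : Matrix ι ι ℝ) (hs : Pᵀ = P) (hp : P * P = P) :
    Matrix.unitaryGroup ι ℂ :=
  realUnitary ((2 : ℝ) • P - 1) (reflection_mul_transpose hs hp)

lemma reflectionGate_mulVec (P : Matrix ι ι ℝ) (hs : Pᵀ = P) (hp : P * P = P) (v : ι → ℝ) :
    (reflectionGate P hs hp : Matrix ι ι ℂ) *ᵥ (fun i => (v i : ℂ)) =
      fun i => ((2 * (P *ᵥ v) i - v i : ℝ) : ℂ) := by
  rw [reflectionGate, realUnitary_mulVec]
  funext i
  rw [sub_mulVec, smul_mulVec, one_mulVec]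
  simp

/-- Every real unit vector can be prepared from a basis state. -/
lemma exists_unitary_mulVec_single {g : ι → ℝ} (hg : g ⬝ᵥ g = 1) (i₀ : ι) :
    ∃ U : Matrix.unitaryGroup ι ℂ, (U : Matrix ι ι ℂ) *ᵥ Pi.single i₀ 1 = fun i => (g i : ℂ) := by
  have hsingle : (Pi.single i₀ 1 : ι → ℂ) = fun i => ((Pi.single i₀ (1 : ℝ) : ι → ℝ) i : ℂ) := by
    funext i
    by_cases h : i = i₀ <;> simp [h]
  set e : ι → ℝ := Pi.single i₀ 1
  have hee : e ⬝ᵥ e = 1 := by simp [e]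
  have hge : g ⬝ᵥ e = g i₀ := by simp [e]
  rw [hsingle]
  -- Reflection in the line through `g + e` swaps the unit vectors `e` and `g`; if `g = -e` that
  -- line degenerates and `-1` does the job.
  by_cases h0 : g + e = 0
  · refine ⟨realUnitary (-1) (by simp), ?_⟩
    rw [realUnitary_mulVec]
    funext i
    have := congrFun h0 i
    simp only [Pi.add_apply, Pi.zero_apply] at this
    rw [neg_mulVec, one_mulVec, Pi.neg_apply, ← eq_neg_of_add_eq_zero_left this]
  · set v := g + e with hv
    have hvv : v ⬝ᵥ v ≠ 0 := fun h => h0 (dotProduct_self_eq_zero.1 h)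
    have hve : 2 * (v ⬝ᵥ e) = v ⬝ᵥ v := by
      simp only [hv, add_dotProduct, dotProduct_add, hg, hee, hge, dotProduct_comm e g]
      ring
    refine ⟨reflectionGate ((v ⬝ᵥ v)⁻¹ • vecMulVec v v) ?_ ?_, ?_⟩
    · rw [transpose_smul, transpose_vecMulVec]
    · rw [smul_mul_smul_comm, vecMulVec_mul_vecMulVec, vecMulVec_smul, smul_smul]
      congr 1
      field_simp
    · rw [reflectionGate_mulVec]
      funext i
      rw [smul_mulVec, vecMulVec_mulVec]
      have : 2 * ((v ⬝ᵥ v)⁻¹ * (v i * (v ⬝ᵥ e))) - e i = g i := by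
        have : 2 * ((v ⬝ᵥ v)⁻¹ * (v i * (v ⬝ᵥ e))) = v i := by
          rw [show 2 * ((v ⬝ᵥ v)⁻¹ * (v i * (v ⬝ᵥ e))) = (v ⬝ᵥ v)⁻¹ * (v i * (2 * (v ⬝ᵥ e))) by ring,
            hve]
          field_simp
        rw [this, hv]
        simp
      rw [← this]
      simp [mul_comm]

end RealUnitaries

/-! ### Three-parameter search states and the gates acting on them -/

section SearchStates

variable {K m : ℕ}

/-- The amplitudes of `(|0⟩ - |1⟩) / √2` in the answer qubit. -/
noncomputable def minusAmp (b : Bool) : ℝ := cond b (-1 / √2) (1 / √2)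

/-- The answer-qubit state `cos η |-⟩ + sin η |+⟩`, divided by `√m`: the amplitude of a basis state
in the uniform superposition over a block of size `m`. -/
noncomputable def uniformAmp (m : ℕ) (η : ℝ) (b : Bool) : ℝ :=
  cond b (sin η - cos η) (sin η + cos η) / (√2 * √(m : ℝ))

lemma minusAmp_not (b : Bool) : minusAmp (!b) = -minusAmp b := by
  cases b <;> simp [minusAmp, neg_div]

lemma uniformAmp_not (m : ℕ) (η : ℝ) (b : Bool) :
    uniformAmp m η (!b) = uniformAmp m η b - 2 * (cos η / √(m : ℝ)) * minusAmp b := by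
  cases b <;> simp only [minusAmp, uniformAmp, Bool.not_true, Bool.not_false, cond_true,
    cond_false, div_eq_mul_inv, mul_inv] <;> ring

lemma sum_uniformAmp_sq (m : ℕ) (η : ℝ) :
    ∑ b, uniformAmp m η b * uniformAmp m η b = 1 / (m : ℝ) := by
  simp only [uniformAmp, Fintype.sum_bool, cond_true, cond_false]
  rw [div_mul_div_comm, div_mul_div_comm, ← add_div, mul_mul_mul_comm,
    mul_self_sqrt (by norm_num), mul_self_sqrt (by positivity), one_div, mul_comm (2 : ℝ), mul_comm]
  rw [show (sin η - cos η) * (sin η - cos η) + (sin η + cos η) * (sin η + cos η) =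
    2 * (sin η ^ 2 + cos η ^ 2) by ring, sin_sq_add_cos_sq]
  rcases eq_or_ne (m : ℝ) 0 with h | h
  · simp [h]
  · field_simp

lemma sum_uniformAmp_mul_minusAmp (m : ℕ) (η : ℝ) :
    ∑ b, uniformAmp m η b * minusAmp b = cos η / √(m : ℝ) := by
  have h2 : (√2)⁻¹ * (√2)⁻¹ = (2 : ℝ)⁻¹ := by rw [← mul_inv, mul_self_sqrt (by norm_num)]
  simp only [uniformAmp, minusAmp, Fintype.sum_bool, cond_true, cond_false, div_eq_mul_inv, mul_inv]
  linear_combination (2 * cos η * (√(m : ℝ))⁻¹) * h2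

/-- The vector `a |t⟩|-⟩ + β |t.1⟩|u⟩ + s ∑_y |y⟩|u⟩`, where `|u⟩` is the uniform superposition over
a block tensored with the answer-qubit state `cos η |-⟩ + sin η |+⟩`. -/
noncomputable def searchVec (η : ℝ) (t : Fin K × Fin m) (a β s : ℝ) (i : QBasis (Fin K × Fin m) 1) :
    ℝ :=
  (if i.1 = t then a * minusAmp i.2.1 else 0) + (if i.1.1 = t.1 then β * uniformAmp m η i.2.1 else 0)
    + s * uniformAmp m η i.2.1

/-- The projection onto the span of the uniform superpositions over the blocks. -/
noncomputable def blockProj (K m : ℕ) (η : ℝ) :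
    Matrix (QBasis (Fin K × Fin m) 1) (QBasis (Fin K × Fin m) 1) ℝ :=
  .of fun i j => if i.1.1 = j.1.1 then uniformAmp m η i.2.1 * uniformAmp m η j.2.1 else 0

/-- The projection onto the uniform superposition over all addresses. -/
noncomputable def globalProj (K m : ℕ) (η : ℝ) :
    Matrix (QBasis (Fin K × Fin m) 1) (QBasis (Fin K × Fin m) 1) ℝ :=
  .of fun i j => (K : ℝ)⁻¹ * (uniformAmp m η i.2.1 * uniformAmp m η j.2.1)

lemma sum_qbasis (F : QBasis (Fin K × Fin m) 1 → ℝ) :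
    ∑ i, F i = ∑ y, ∑ z, ∑ b, F ((y, z), b, 0) := by
  simp [Fintype.sum_prod_type]

lemma sum_block_uniformAmp_sq (hm : 1 ≤ m) (η : ℝ) (y : Fin K) :
    ∑ j : QBasis (Fin K × Fin m) 1,
      (if y = j.1.1 then uniformAmp m η j.2.1 * uniformAmp m η j.2.1 else 0) = 1 := by
  have hm0 : (m : ℝ) ≠ 0 := by positivity
  rw [sum_qbasis, Finset.sum_eq_single y (fun y' _ h => by simp [h.symm]) (by simp)]
  simp only [if_true, sum_uniformAmp_sq]
  simp [hm0]

lemma sum_uniformAmp_sq_eq (hm : 1 ≤ m) (η : ℝ) :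
    ∑ j : QBasis (Fin K × Fin m) 1, uniformAmp m η j.2.1 * uniformAmp m η j.2.1 = K := by
  have hm0 : (m : ℝ) ≠ 0 := by positivity
  rw [sum_qbasis]
  simp only [sum_uniformAmp_sq]
  simp [hm0]

lemma sum_block_searchVec (hm : 1 ≤ m) (η : ℝ) (t : Fin K × Fin m) (a β s : ℝ) (y : Fin K) :
    ∑ j, (if y = j.1.1 then uniformAmp m η j.2.1 * searchVec η t a β s j else 0) =
      (if y = t.1 then a * (cos η / √(m : ℝ)) + β else 0) + s := by
  have hm0 : (m : ℝ) ≠ 0 := by positivity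
  rw [sum_qbasis, Finset.sum_eq_single y (fun y' _ h => by simp [h.symm]) (by simp)]
  have hz : ∀ z : Fin m, ∑ b, (if y = y then uniformAmp m η b *
      searchVec η t a β s ((y, z), b, 0) else 0) = (if z = t.2 then
        (if y = t.1 then a * (cos η / √(m : ℝ)) else 0) else 0) +
        ((if y = t.1 then β else 0) + s) * (1 / m) := by
    intro z
    rw [← sum_uniformAmp_mul_minusAmp, ← sum_uniformAmp_sq m η]
    obtain ⟨y₀, z₀⟩ := t
    simp only [searchVec, if_true, Prod.mk.injEq, Fintype.sum_bool]
    split_ifs <;> simp_all <;> ring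
  rw [Finset.sum_congr rfl fun z _ => hz z, Finset.sum_add_distrib]
  simp only [Finset.sum_ite_eq', Finset.mem_univ, if_true, Finset.sum_const, Finset.card_univ,
    Fintype.card_fin, nsmul_eq_mul]
  split_ifs <;> field_simp <;> ring

lemma sum_searchVec (hm : 1 ≤ m) (η : ℝ) (t : Fin K × Fin m) (a β s : ℝ) :
    ∑ j, uniformAmp m η j.2.1 * searchVec η t a β s j =
      a * (cos η / √(m : ℝ)) + β + K * s := by
  have h : ∀ j : QBasis (Fin K × Fin m) 1, uniformAmp m η j.2.1 * searchVec η t a β s j =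
      ∑ y, if y = j.1.1 then uniformAmp m η j.2.1 * searchVec η t a β s j else 0 := by
    intro j
    simp
  rw [Finset.sum_congr rfl fun j _ => h j, Finset.sum_comm]
  simp only [sum_block_searchVec hm]
  rw [Finset.sum_add_distrib]
  simp

lemma blockProj_transpose (η : ℝ) : (blockProj K m η)ᵀ = blockProj K m η := by
  ext i j
  simp only [blockProj, transpose_apply, of_apply, mul_comm, eq_comm]

lemma globalProj_transpose (η : ℝ) : (globalProj K m η)ᵀ = globalProj K m η := by
  ext i j
  simp only [globalProj, transpose_apply, of_apply]
  ring

lemma blockProj_mul_self (hm : 1 ≤ m) (η : ℝ) :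
    blockProj K m η * blockProj K m η = blockProj K m η := by
  ext i k
  have h : ∀ j : QBasis (Fin K × Fin m) 1, blockProj K m η i j * blockProj K m η j k =
      blockProj K m η i k *
        (if i.1.1 = j.1.1 then uniformAmp m η j.2.1 * uniformAmp m η j.2.1 else 0) := by
    intro j
    simp only [blockProj, of_apply]
    split_ifs <;> simp_all; ring
  rw [mul_apply, Finset.sum_congr rfl fun j _ => h j, ← Finset.mul_sum,
    sum_block_uniformAmp_sq hm, mul_one]

lemma globalProj_mul_self (hK : 1 ≤ K) (hm : 1 ≤ m) (η : ℝ) :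
    globalProj K m η * globalProj K m η = globalProj K m η := by
  ext i k
  have hK0 : (K : ℝ) ≠ 0 := by positivity
  have h : ∀ j : QBasis (Fin K × Fin m) 1, globalProj K m η i j * globalProj K m η j k =
      globalProj K m η i k * (K : ℝ)⁻¹ * (uniformAmp m η j.2.1 * uniformAmp m η j.2.1) := by
    intro j
    simp only [globalProj, of_apply]
    ring
  rw [mul_apply, Finset.sum_congr rfl fun j _ => h j, ← Finset.mul_sum,
    sum_uniformAmp_sq_eq hm, mul_assoc, inv_mul_cancel₀ hK0, mul_one]

lemma blockProj_mulVec (hm : 1 ≤ m) (η : ℝ) (t : Fin K × Fin m) (a β s : ℝ)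
    (i : QBasis (Fin K × Fin m) 1) :
    (blockProj K m η *ᵥ searchVec η t a β s) i = uniformAmp m η i.2.1 *
      ((if i.1.1 = t.1 then a * (cos η / √(m : ℝ)) + β else 0) + s) := by
  rw [← sum_block_searchVec hm, Finset.mul_sum]
  refine Finset.sum_congr rfl fun j _ => ?_
  simp only [blockProj, of_apply]
  split_ifs <;> ring

lemma globalProj_mulVec (hm : 1 ≤ m) (η : ℝ) (t : Fin K × Fin m) (a β s : ℝ)
    (i : QBasis (Fin K × Fin m) 1) :
    (globalProj K m η *ᵥ searchVec η t a β s) i = uniformAmp m η i.2.1 * ((K : ℝ)⁻¹ *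
      (a * (cos η / √(m : ℝ)) + β + K * s)) := by
  rw [← sum_searchVec hm, Finset.mul_sum, Finset.mul_sum]
  refine Finset.sum_congr rfl fun j _ => ?_
  simp only [globalProj, of_apply]
  ring

/-- Reflection in the uniform superpositions over the blocks. -/
noncomputable def blockGate (K : ℕ) (hm : 1 ≤ m) (η : ℝ) :
    Matrix.unitaryGroup (QBasis (Fin K × Fin m) 1) ℂ :=
  reflectionGate (blockProj K m η) (blockProj_transpose η) (blockProj_mul_self hm η)

/-- Reflection in the uniform superposition over all addresses. -/
noncomputable def globalGate (hK : 1 ≤ K) (hm : 1 ≤ m) (η : ℝ) :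
    Matrix.unitaryGroup (QBasis (Fin K × Fin m) 1) ℂ :=
  reflectionGate (globalProj K m η) (globalProj_transpose η) (globalProj_mul_self hK hm η)

/-- `searchVec`, as a vector of complex amplitudes. -/
noncomputable def searchState (η : ℝ) (t : Fin K × Fin m) (a β s : ℝ) :
    QBasis (Fin K × Fin m) 1 → ℂ :=
  fun i => (searchVec η t a β s i : ℂ)

lemma blockGate_searchState (hm : 1 ≤ m) (η : ℝ) (t : Fin K × Fin m) (a β s : ℝ) :
    (blockGate K hm η : Matrix _ _ ℂ) *ᵥ searchState η t a β s =
      searchState η t (-a) (β + 2 * (cos η / √(m : ℝ)) * a) s := by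
  unfold searchState blockGate
  rw [reflectionGate_mulVec]
  funext i
  rw [blockProj_mulVec hm]
  congr 1
  simp only [searchVec]
  split_ifs <;> ring

lemma globalGate_searchState (hK : 1 ≤ K) (hm : 1 ≤ m) (η : ℝ) (t : Fin K × Fin m) (a β s : ℝ) :
    (globalGate hK hm η : Matrix _ _ ℂ) *ᵥ searchState η t a β s =
      searchState η t (-a) (-β) (s + 2 / K * (cos η / √(m : ℝ) * a + β)) := by
  have hK0 : (K : ℝ) ≠ 0 := by positivity
  unfold searchState globalGate
  rw [reflectionGate_mulVec]
  funext i
  rw [globalProj_mulVec hm]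
  congr 1
  simp only [searchVec]
  have : (K : ℝ)⁻¹ * (a * (cos η / √(m : ℝ)) + β + K * s) =
      1 / K * (cos η / √(m : ℝ) * a + β) + s := by
    field_simp
  rw [this]
  split_ifs <;> ring

/-- A query negates the `|-⟩` component at `t` and fixes the `|+⟩` component; the block vectors
overlap `|t⟩|-⟩` in `cos η / √m`. -/
lemma oracle_searchState (η : ℝ) {f : Fin K × Fin m → Bool} {t : Fin K × Fin m}
    (hf : ∀ x, f x = true ↔ x = t) (a β s : ℝ) :
    oracle f (searchState η t a β s) =
      searchState η t (-a - 2 * (cos η / √(m : ℝ)) * (β + s)) β s := by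
  funext i
  obtain ⟨x, b, w⟩ := i
  refine congrArg Complex.ofReal (?_ : searchVec η t a β s (x, xor b (f x), w) = _)
  by_cases h : x = t
  · subst h
    have hx : f x = true := (hf x).2 rfl
    simp only [searchVec, hx, Bool.xor_true, if_true, minusAmp_not, uniformAmp_not]
    ring
  · have hx : f x = false := by simpa using mt (hf x).1 h
    simp [searchVec, hx, h]

/-- With the first two coefficients zero the state does not involve `t`, so one unitary serves all
databases. -/
lemma exists_prepare_uniform (hK : 1 ≤ K) (hm : 1 ≤ m) (η : ℝ) (i₀ : QBasis (Fin K × Fin m) 1) :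
    ∃ U : Matrix.unitaryGroup (QBasis (Fin K × Fin m) 1) ℂ, ∀ t : Fin K × Fin m,
      (U : Matrix (QBasis (Fin K × Fin m) 1) (QBasis (Fin K × Fin m) 1) ℂ) *ᵥ
        Pi.single i₀ 1 = searchState η t 0 0 (1 / √(K : ℝ)) := by
  have hK0 : (K : ℝ) ≠ 0 := by positivity
  obtain ⟨U, hU⟩ := exists_unitary_mulVec_single
    (g := fun i : QBasis (Fin K × Fin m) 1 => 1 / √(K : ℝ) * uniformAmp m η i.2.1) (by
      unfold dotProduct
      rw [Finset.sum_congr rfl fun i _ => mul_mul_mul_comm _ _ _ _, ← Finset.mul_sum,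
        sum_uniformAmp_sq_eq hm, div_mul_div_comm, mul_self_sqrt (by positivity)]
      field_simp) i₀
  refine ⟨U, fun t => hU.trans ?_⟩
  funext i
  simp [searchState, searchVec]

end SearchStates

/-! ### Closed forms for the coefficients -/

section Coefficients

/-- Coefficient of `|t⟩|-⟩` after `j` global iterations. -/
noncomputable def globalTarget (θ : ℝ) (j : ℕ) : ℝ := sin (2 * j * θ) / cos θ

/-- Coefficient of every block after `j` global iterations. -/
noncomputable def globalBlock (K : ℕ) (θ : ℝ) (j : ℕ) : ℝ :=
  cos ((2 * j + 1) * θ) / (√(K : ℝ) * cos θ)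

lemma globalTarget_succ {K : ℕ} (hK : 1 ≤ K) {θ : ℝ} (hθ : cos θ ≠ 0) (j : ℕ) :
    globalTarget θ (j + 1) =
      globalTarget θ j + 2 * (√(K : ℝ) * sin θ) * globalBlock K θ j := by
  have hs : √(K : ℝ) ≠ 0 := by positivity
  have h₁ : sin (2 * (j + 1 : ℕ) * θ) = sin ((2 * j + 1) * θ + θ) := by push_cast; ring_nf
  have h₂ : sin (2 * j * θ) = sin ((2 * j + 1) * θ - θ) := by ring_nf
  unfold globalTarget globalBlock
  rw [h₁, h₂, sin_add, sin_sub]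
  field_simp
  ring

lemma globalBlock_succ {K : ℕ} (hK : 1 ≤ K) {θ : ℝ} (hθ : cos θ ≠ 0) (j : ℕ) :
    globalBlock K θ (j + 1) =
      globalBlock K θ j - 2 / K * (√(K : ℝ) * sin θ) * globalTarget θ (j + 1) := by
  have hs : √(K : ℝ) ≠ 0 := by positivity
  have hK0 : (K : ℝ) ≠ 0 := by positivity
  have hKK : √(K : ℝ) * √(K : ℝ) = K := mul_self_sqrt (by positivity)
  have h₁ : cos ((2 * (j + 1 : ℕ) + 1) * θ) = cos (2 * (j + 1 : ℕ) * θ + θ) := by ring_nf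
  have h₂ : cos ((2 * j + 1) * θ) = cos (2 * (j + 1 : ℕ) * θ - θ) := by push_cast; ring_nf
  unfold globalTarget globalBlock
  rw [h₁, h₂, cos_add, cos_sub]
  field_simp
  linear_combination (2 * sin (2 * (j + 1 : ℕ) * θ) * sin θ) * hKK

/-- Coefficient of the target block after `i` local iterations that start from amplitude `x` in the
direction of the target and amplitude `y` in the rest of the block. -/
noncomputable def localBlock (ω x y : ℝ) (i : ℕ) : ℝ :=
  (cos (2 * i * ω) * y - sin (2 * i * ω) * x) / cos ω

/-- Coefficient of `|t⟩|-⟩` after `i` local iterations. -/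
noncomputable def localTarget (ω x y : ℝ) (i : ℕ) : ℝ :=
  cos (2 * i * ω) * x + sin (2 * i * ω) * y - sin ω * localBlock ω x y i

lemma localTarget_succ {ω : ℝ} (hω : cos ω ≠ 0) (x y : ℝ) (i : ℕ) :
    localTarget ω x y (i + 1) = localTarget ω x y i + 2 * sin ω * localBlock ω x y i := by
  have h₁ : 2 * ((i + 1 : ℕ) : ℝ) * ω = 2 * i * ω + 2 * ω := by push_cast; ring
  unfold localTarget localBlock
  rw [h₁, cos_add, sin_add, cos_two_mul, sin_two_mul]
  field_simp
  rw [← sub_eq_zero]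
  ring_nf
  have h3 : sin ω ^ 2 = 1 - cos ω ^ 2 := by linarith [sin_sq_add_cos_sq ω]
  simp only [h3]
  ring

lemma localBlock_succ {ω : ℝ} (hω : cos ω ≠ 0) (x y : ℝ) (i : ℕ) :
    localBlock ω x y (i + 1) = localBlock ω x y i - 2 * sin ω * localTarget ω x y (i + 1) := by
  rw [localTarget_succ hω]
  have h₁ : 2 * ((i + 1 : ℕ) : ℝ) * ω = 2 * i * ω + 2 * ω := by push_cast; ring
  unfold localTarget localBlock
  rw [h₁, cos_add, sin_add, cos_two_mul, sin_two_mul]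
  field_simp
  rw [← sub_eq_zero]
  ring_nf
  have h3 : sin ω ^ 2 = 1 - cos ω ^ 2 := by linarith [sin_sq_add_cos_sq ω]
  simp only [h3]
  ring

/-- The left side is the overlap of the target block's state with its uniform vector, which the
final reflection averages over blocks. -/
lemma sin_mul_localTarget_add {ω : ℝ} (hω : cos ω ≠ 0) (x y : ℝ) (k : ℕ) :
    sin ω * localTarget ω x y (k + 1) + localBlock ω x y (k + 1) =
      cos ((2 * k + 1) * ω) * y - sin ((2 * k + 1) * ω) * x := by
  have h₁ : (2 * k + 1) * ω = 2 * (k + 1 : ℕ) * ω - ω := by push_cast; ring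
  unfold localTarget localBlock
  rw [h₁, cos_sub, sin_sub]
  field_simp
  rw [← sub_eq_zero]
  ring_nf
  have h3 : sin ω ^ 2 = 1 - cos ω ^ 2 := by linarith [sin_sq_add_cos_sq ω]
  simp only [h3]
  ring

/-- Amplitude in the direction of the target at the start of the local iterations. -/
noncomputable def localStartTarget (K : ℕ) (θ ω : ℝ) (j : ℕ) : ℝ :=
  globalTarget θ j + sin ω * globalBlock K θ j

/-- Up to a factor, the amplitude of the other blocks after `j` global iterations, `k + 1` local
ones and a final reflection in the uniform superposition. -/
noncomputable def leakage (K : ℕ) (θ ω : ℝ) (j k : ℕ) : ℝ :=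
  cos ((2 * k + 1) * ω) * (cos ω * globalBlock K θ j) -
    sin ((2 * k + 1) * ω) * localStartTarget K θ ω j + (K / 2 - 1) * globalBlock K θ j

end Coefficients

/-! ### The partial search algorithm and its exactness -/

section Algorithm

variable {K m : ℕ}

/-- Basis states of an address register and the answer qubit. -/
abbrev SearchBasis (K m : ℕ) : Type := QBasis (Fin K × Fin m) 1

/-- The angles of a global and a local iteration, when the answer qubit is in the state
`cos η |-⟩ + sin η |+⟩`. -/
structure IsSearchAngles (K m : ℕ) (η θ ω : ℝ) : Prop where
  sin_local : sin ω = cos η / √(m : ℝ)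
  sin_global : √(K : ℝ) * sin θ = cos η / √(m : ℝ)
  cos_local_ne : cos ω ≠ 0
  cos_global_ne : cos θ ≠ 0

/-- The gates for `j` global iterations, followed by `k + 1` local ones in every block and a
reflection in the uniform superposition. -/
noncomputable def partialSearchGate (hK : 1 ≤ K) (hm : 1 ≤ m) (η : ℝ) (j k : ℕ)
    (U : Matrix.unitaryGroup (SearchBasis K m) ℂ) (s : ℕ) :
    Matrix.unitaryGroup (SearchBasis K m) ℂ :=
  if s = 0 then U else if s ≤ j then globalGate hK hm η else
    if s ≤ j + k then blockGate K hm η else globalGate hK hm η * blockGate K hm η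

/-- The algorithm with gates `partialSearchGate` that answers with the block of the measured
address. -/
noncomputable def partialSearch (hK : 1 ≤ K) (hm : 1 ≤ m) (η : ℝ) (j k : ℕ)
    (i₀ : SearchBasis K m) (U : Matrix.unitaryGroup (SearchBasis K m) ℂ) :
    PartialSearchAlgorithm K m where
  work := 1
  queries := j + k + 1
  init := i₀
  gate := partialSearchGate hK hm η j k U
  output i := i.1.1

/-- The state of `partialSearch` after `s` queries. -/
noncomputable def partialSearchState (hK : 1 ≤ K) (hm : 1 ≤ m) (η : ℝ) (j k : ℕ)
    (i₀ : SearchBasis K m) (U : Matrix.unitaryGroup (SearchBasis K m) ℂ)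
    (f : Fin K × Fin m → Bool) (s : ℕ) : SearchBasis K m → ℂ :=
  (partialSearch hK hm η j k i₀ U).state f s

lemma partialSearchState_succ (hK : 1 ≤ K) (hm : 1 ≤ m) (η : ℝ) (j k : ℕ)
    (i₀ : SearchBasis K m) (U : Matrix.unitaryGroup (SearchBasis K m) ℂ)
    (f : Fin K × Fin m → Bool) (s : ℕ) :
    partialSearchState hK hm η j k i₀ U f (s + 1) =
      (partialSearchGate hK hm η j k U (s + 1) : Matrix (SearchBasis K m) (SearchBasis K m) ℂ) *ᵥ
        oracle f (partialSearchState hK hm η j k i₀ U f s) := rfl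

lemma partialSearchState_global (hK : 1 ≤ K) (hm : 1 ≤ m) {η θ ω : ℝ}
    (ha : IsSearchAngles K m η θ ω) {i₀ : SearchBasis K m}
    {U : Matrix.unitaryGroup (SearchBasis K m) ℂ} {f : Fin K × Fin m → Bool} {t : Fin K × Fin m}
    (hU : (U : Matrix (SearchBasis K m) (SearchBasis K m) ℂ) *ᵥ Pi.single i₀ 1 =
      searchState η t 0 0 (1 / √(K : ℝ))) (hf : ∀ x, f x = true ↔ x = t)
    (j k s : ℕ) (hs : s ≤ j) :
    partialSearchState hK hm η j k i₀ U f s =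
      searchState η t (globalTarget θ s) 0 (globalBlock K θ s) := by
  have hcθ := ha.cos_global_ne
  induction s with
  | zero =>
    refine hU.trans ?_
    congr 1
    · simp [globalTarget]
    · simp only [globalBlock]
      field_simp
      simp
  | succ s ih =>
    have hg : partialSearchGate hK hm η j k U (s + 1) = globalGate hK hm η := by
      simp [partialSearchGate, hs]
    rw [partialSearchState_succ, ih (by omega), hg, oracle_searchState η hf,
      globalGate_searchState, globalBlock_succ hK hcθ, globalTarget_succ hK hcθ, ha.sin_global]
    congr 1 <;> ring

lemma partialSearchState_local (hK : 1 ≤ K) (hm : 1 ≤ m) {η θ ω : ℝ}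
    (ha : IsSearchAngles K m η θ ω) {i₀ : SearchBasis K m}
    {U : Matrix.unitaryGroup (SearchBasis K m) ℂ} {f : Fin K × Fin m → Bool} {t : Fin K × Fin m}
    (hU : (U : Matrix (SearchBasis K m) (SearchBasis K m) ℂ) *ᵥ Pi.single i₀ 1 =
      searchState η t 0 0 (1 / √(K : ℝ))) (hf : ∀ x, f x = true ↔ x = t)
    (j k s : ℕ) (hs : s ≤ k) :
    partialSearchState hK hm η j k i₀ U f (j + s) =
      searchState η t
        (localTarget ω (localStartTarget K θ ω j) (cos ω * globalBlock K θ j) s)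
        (localBlock ω (localStartTarget K θ ω j) (cos ω * globalBlock K θ j) s - globalBlock K θ j)
        (globalBlock K θ j) := by
  have hcω := ha.cos_local_ne
  induction s with
  | zero =>
    rw [add_zero, partialSearchState_global hK hm ha hU hf j k j le_rfl]
    congr 1
    · simp only [localTarget, localBlock, localStartTarget]
      field_simp
      simp
      ring
    · simp only [localBlock]
      field_simp
      simp
  | succ s ih =>
    have hg : partialSearchGate hK hm η j k U (j + s + 1) = blockGate K hm η := by
      have h₁ : ¬ j + s + 1 ≤ j := by omega
      have h₂ : j + s + 1 ≤ j + k := by omega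
      simp [partialSearchGate, h₁, h₂]
    rw [← add_assoc, partialSearchState_succ, ih (by omega), hg, oracle_searchState η hf,
      blockGate_searchState, localBlock_succ hcω, localTarget_succ hcω, ha.sin_local]
    congr 1 <;> ring

lemma partialSearchState_final (hK : 1 ≤ K) (hm : 1 ≤ m) {η θ ω : ℝ}
    (ha : IsSearchAngles K m η θ ω) {i₀ : SearchBasis K m}
    {U : Matrix.unitaryGroup (SearchBasis K m) ℂ} {f : Fin K × Fin m → Bool} {t : Fin K × Fin m}
    (hU : (U : Matrix (SearchBasis K m) (SearchBasis K m) ℂ) *ᵥ Pi.single i₀ 1 =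
      searchState η t 0 0 (1 / √(K : ℝ))) (hf : ∀ x, f x = true ↔ x = t)
    (j k : ℕ) (h0 : leakage K θ ω j k = 0) :
    ∃ a β : ℝ, partialSearchState hK hm η j k i₀ U f (j + k + 1) = searchState η t a β 0 := by
  have hK0 : (K : ℝ) ≠ 0 := by positivity
  have hg : partialSearchGate hK hm η j k U (j + k + 1) =
      globalGate hK hm η * blockGate K hm η := by
    have h₁ : ¬ j + k + 1 ≤ j := by omega
    simp [partialSearchGate, h₁]
  rw [partialSearchState_succ, partialSearchState_local hK hm ha hU hf j k k le_rfl, hg,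
    oracle_searchState η hf, Submonoid.coe_mul, ← mulVec_mulVec, blockGate_searchState,
    globalGate_searchState]
  -- The common block coefficient after the last reflection is `2/K` times the leakage.
  refine ⟨_, _, congrArg _ ?_⟩
  set x := localStartTarget K θ ω j
  set y := cos ω * globalBlock K θ j
  have h₁ := sin_mul_localTarget_add ha.cos_local_ne x y k
  rw [localBlock_succ ha.cos_local_ne, localTarget_succ ha.cos_local_ne] at h₁
  have h₂ : leakage K θ ω j k = cos ((2 * k + 1) * ω) * y - sin ((2 * k + 1) * ω) * x +
    (K / 2 - 1) * globalBlock K θ j := rfl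
  rw [h0, ← h₁] at h₂
  rw [← ha.sin_local]
  field_simp
  linear_combination (-2 : ℝ) * h₂

theorem exists_exact_partialSearch (hK : 1 ≤ K) (hm : 1 ≤ m) {η θ ω : ℝ}
    (ha : IsSearchAngles K m η θ ω) (j k : ℕ) (h0 : leakage K θ ω j k = 0) :
    ∃ A : PartialSearchAlgorithm K m, A.queries = j + k + 1 ∧ A.SucceedsWithProb 1 := by
  set i₀ : SearchBasis K m := ((⟨0, hK⟩, ⟨0, hm⟩), false, 0)
  obtain ⟨U, hU⟩ := exists_prepare_uniform hK hm η i₀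
  refine ⟨partialSearch hK hm η j k i₀ U, rfl, fun f t hf => ?_⟩
  obtain ⟨a, β, hst⟩ := partialSearchState_final hK hm ha (hU t) hf j k h0
  have hsum : ∑ i, ‖partialSearchState hK hm η j k i₀ U f (j + k + 1) i‖ ^ 2 = 1 :=
    QueryAlgorithm.sum_norm_sq_state (partialSearch hK hm η j k i₀ U) f (j + k + 1)
  change 1 ≤ ∑ i : SearchBasis K m with i.1.1 = t.1,
    ‖partialSearchState hK hm η j k i₀ U f (j + k + 1) i‖ ^ 2
  rw [Finset.sum_filter, ← hsum]
  -- With zero common coefficient the final state is supported on the target block.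
  refine Finset.sum_le_sum fun i _ => ?_
  rw [hst]
  split_ifs with h
  · exact le_rfl
  · have h' : i.1 ≠ t := fun h' => h (congrArg Prod.fst h')
    simp only [searchState, searchVec]
    simp [h, h']

end Algorithm

/-! ### The leakage for large blocks -/

section Asymptotics

lemma tendsto_arcsin_one_div_atTop : Tendsto (fun x : ℝ => arcsin (1 / x)) atTop (nhds 0) := by
  have h : Tendsto (fun x : ℝ => 1 / x) atTop (nhds 0) := by
    simpa using tendsto_inv_atTop_zero (𝕜 := ℝ)
  simpa [Function.comp_def] using (continuous_arcsin.tendsto 0).comp h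

lemma tendsto_mul_arcsin_one_div_atTop :
    Tendsto (fun x : ℝ => x * arcsin (1 / x)) atTop (nhds 1) := by
  have hd := (hasDerivAt_arcsin (x := 0) (by norm_num) (by norm_num)).tendsto_slope_zero
  have h0 : Tendsto (fun x : ℝ => x⁻¹) atTop (nhdsWithin 0 {0}ᶜ) :=
    tendsto_inv_atTop_nhdsGT_zero.mono_right (nhdsWithin_mono _ fun x hx => ne_of_gt hx)
  simpa [Function.comp_def] using hd.comp h0

lemma tendsto_floor_mul_arcsin {a : ℝ} (ha : 0 ≤ a) :
    Tendsto (fun x : ℝ => 2 * (⌊a / 2 * x⌋₊ : ℝ) * arcsin (1 / x)) atTop (nhds a) := by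
  have h := ((tendsto_nat_floor_mul_div_atTop (show 0 ≤ a / 2 by positivity)).const_mul 2).mul
    tendsto_mul_arcsin_one_div_atTop
  rw [show 2 * (a / 2) * 1 = a by ring] at h
  refine h.congr' ?_
  filter_upwards [eventually_gt_atTop 0] with x hx
  field_simp

/-- The limit of the leakage as the blocks grow, if the global iterations stop at an angle `δ` from
the target and the local ones turn by `Δ`. -/
lemma tendsto_leakage {K : ℕ} (hK : 1 ≤ K) {δ Δ : ℝ} (hδ : δ ≤ π / 2) (hΔ : 0 < Δ) :
    Tendsto (fun m : ℕ => leakage K (arcsin (1 / √((K * m : ℕ) : ℝ))) (arcsin (1 / √(m : ℝ)))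
      ⌊(π / 2 - δ) / 2 * √((K * m : ℕ) : ℝ)⌋₊ (⌊Δ / 2 * √(m : ℝ)⌋₊ - 1)) atTop
      (nhds (cos Δ * (sin δ / √(K : ℝ)) - sin Δ * cos δ + (K / 2 - 1) * (sin δ / √(K : ℝ)))) := by
  have hsm : Tendsto (fun m : ℕ => √(m : ℝ)) atTop atTop :=
    tendsto_sqrt_atTop.comp tendsto_natCast_atTop_atTop
  have hsN : Tendsto (fun m : ℕ => √((K * m : ℕ) : ℝ)) atTop atTop :=
    tendsto_sqrt_atTop.comp
      (tendsto_natCast_atTop_atTop.comp (tendsto_id.const_mul_atTop' (by omega)))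
  set θ : ℕ → ℝ := fun m => arcsin (1 / √((K * m : ℕ) : ℝ))
  set ω : ℕ → ℝ := fun m => arcsin (1 / √(m : ℝ))
  set j : ℕ → ℕ := fun m => ⌊(π / 2 - δ) / 2 * √((K * m : ℕ) : ℝ)⌋₊
  set k : ℕ → ℕ := fun m => ⌊Δ / 2 * √(m : ℝ)⌋₊ - 1
  have hθ : Tendsto θ atTop (nhds 0) := tendsto_arcsin_one_div_atTop.comp hsN
  have hω : Tendsto ω atTop (nhds 0) := tendsto_arcsin_one_div_atTop.comp hsm
  have hj : Tendsto (fun m => 2 * (j m : ℝ) * θ m) atTop (nhds (π / 2 - δ)) :=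
    (tendsto_floor_mul_arcsin (by linarith)).comp hsN
  have hj' : Tendsto (fun m => (2 * (j m : ℝ) + 1) * θ m) atTop (nhds (π / 2 - δ)) := by
    simpa [add_mul] using hj.add hθ
  have hk : Tendsto (fun m => (2 * (k m : ℝ) + 1) * ω m) atTop (nhds Δ) := by
    have h := ((tendsto_floor_mul_arcsin hΔ.le).comp hsm).sub hω
    rw [sub_zero] at h
    refine h.congr' ?_
    filter_upwards [hsm.eventually_ge_atTop (2 / Δ)] with m hm
    -- Keeps the truncated subtraction in `k` exact.
    have h1 : 1 ≤ ⌊Δ / 2 * √(m : ℝ)⌋₊ := by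
      rw [Nat.one_le_floor_iff]
      rw [div_le_iff₀ hΔ] at hm
      linarith
    simp only [k, ω, Function.comp_apply, Nat.cast_sub h1]
    push_cast
    ring
  have hcθ : Tendsto (fun m => cos (θ m)) atTop (nhds 1) := by
    simpa [Function.comp_def] using (continuous_cos.tendsto 0).comp hθ
  have hcω : Tendsto (fun m => cos (ω m)) atTop (nhds 1) := by
    simpa [Function.comp_def] using (continuous_cos.tendsto 0).comp hω
  have hsω : Tendsto (fun m => sin (ω m)) atTop (nhds 0) := by
    simpa [Function.comp_def] using (continuous_sin.tendsto 0).comp hω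
  have hS : Tendsto (fun m => globalBlock K (θ m) (j m)) atTop (nhds (sin δ / √(K : ℝ))) := by
    have h := ((continuous_cos.tendsto _).comp hj').div (hcθ.const_mul √(K : ℝ))
      (by have : √(K : ℝ) ≠ 0 := by positivity
          simpa using this)
    rw [cos_pi_div_two_sub, mul_one] at h
    exact h
  have hA : Tendsto (fun m => globalTarget (θ m) (j m)) atTop (nhds (cos δ)) := by
    have h := ((continuous_sin.tendsto _).comp hj).div hcθ one_ne_zero
    rw [sin_pi_div_two_sub, div_one] at h
    exact h
  have hX : Tendsto (fun m => localStartTarget K (θ m) (ω m) (j m)) atTop (nhds (cos δ)) := by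
    have h := hA.add (hsω.mul hS)
    rw [zero_mul, add_zero] at h
    exact h
  have h := ((((continuous_cos.tendsto _).comp hk).mul (hcω.mul hS)).sub
    (((continuous_sin.tendsto _).comp hk).mul hX)).add (hS.const_mul ((K : ℝ) / 2 - 1))
  rw [one_mul] at h
  exact h

end Asymptotics

/-! ### Tuning the leakage to zero and choosing the angles -/

section Existence

lemma cos_arcsin_div_ne_zero {c r : ℝ} (hc : |c| ≤ 1) (hr : 1 < r) : cos (arcsin (c / r)) ≠ 0 := by
  have h : |c / r| < 1 := by
    rw [abs_div, abs_of_pos (by linarith : 0 < r), div_lt_one (by linarith)]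
    linarith
  rw [cos_arcsin]
  exact (sqrt_pos.2 (by nlinarith [(sq_lt_one_iff_abs_lt_one _).2 h])).ne'

lemma sin_arcsin_div {c r : ℝ} (hc : |c| ≤ 1) (hr : 1 < r) : sin (arcsin (c / r)) = c / r := by
  have h : |c / r| ≤ 1 := by
    rw [abs_div, abs_of_pos (by linarith : 0 < r), div_le_one (by linarith)]
    linarith
  exact sin_arcsin (abs_le.1 h).1 (abs_le.1 h).2

/-- Tilting the answer qubit slows the search down continuously, so that a negative leakage can be
tuned to zero. -/
lemma exists_searchAngles_leakage_eq_zero {K m : ℕ} (hK : 1 ≤ K) (hm : 2 ≤ m) (j k : ℕ)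
    (h : leakage K (arcsin (1 / √((K * m : ℕ) : ℝ))) (arcsin (1 / √(m : ℝ))) j k ≤ 0) :
    ∃ η θ ω, IsSearchAngles K m η θ ω ∧ leakage K θ ω j k = 0 := by
  have hm1 : 1 < √(m : ℝ) := by
    rw [lt_sqrt (by norm_num)]
    exact_mod_cast (by omega : 1 ^ 2 < m)
  have hN1 : 1 < √((K * m : ℕ) : ℝ) := by
    rw [lt_sqrt (by norm_num)]
    exact_mod_cast (by nlinarith : 1 ^ 2 < K * m)
  have hsK : 0 < √(K : ℝ) := by positivity
  set θ : ℝ → ℝ := fun η => arcsin (cos η / √((K * m : ℕ) : ℝ))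
  set ω : ℝ → ℝ := fun η => arcsin (cos η / √(m : ℝ))
  have hcθ : ∀ η, cos (θ η) ≠ 0 := fun η => cos_arcsin_div_ne_zero (abs_cos_le_one η) hN1
  have hcω : ∀ η, cos (ω η) ≠ 0 := fun η => cos_arcsin_div_ne_zero (abs_cos_le_one η) hm1
  have hθc : Continuous θ := continuous_arcsin.comp (continuous_cos.div_const _)
  have hωc : Continuous ω := continuous_arcsin.comp (continuous_cos.div_const _)
  have hS : Continuous fun η => globalBlock K (θ η) j :=
    (continuous_cos.comp (continuous_const.mul hθc)).div
      (continuous_const.mul (continuous_cos.comp hθc)) fun η => mul_ne_zero hsK.ne' (hcθ η)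
  have hA : Continuous fun η => globalTarget (θ η) j :=
    (continuous_sin.comp (continuous_const.mul hθc)).div (continuous_cos.comp hθc) hcθ
  have hcont : Continuous fun η => leakage K (θ η) (ω η) j k := by
    unfold leakage localStartTarget
    fun_prop
  -- Both rotation angles vanish here, and the leakage is `√K / 2`.
  have hend : 0 ≤ leakage K (θ (π / 2)) (ω (π / 2)) j k := by
    have h₁ : θ (π / 2) = 0 := by simp [θ]
    have h₂ : ω (π / 2) = 0 := by simp [ω]
    rw [h₁, h₂]
    simp only [leakage, localStartTarget, globalTarget, globalBlock, mul_zero, cos_zero, sin_zero]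
    have : (1 : ℝ) * (1 * (1 / (√(K : ℝ) * 1))) - 0 * (0 / 1 + 0 * (1 / (√(K : ℝ) * 1))) +
      (K / 2 - 1) * (1 / (√(K : ℝ) * 1)) = K / 2 / √(K : ℝ) := by
      field_simp
      ring
    rw [this]
    positivity
  have hstart : leakage K (θ 0) (ω 0) j k ≤ 0 := by simpa [θ, ω] using h
  obtain ⟨η, -, hη⟩ := intermediate_value_Icc (by positivity : (0 : ℝ) ≤ π / 2)
    hcont.continuousOn ⟨hstart, hend⟩
  refine ⟨η, θ η, ω η, ⟨sin_arcsin_div (abs_cos_le_one η) hm1, ?_, hcω η, hcθ η⟩, hη⟩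
  rw [show sin (θ η) = _ from sin_arcsin_div (abs_cos_le_one η) hN1]
  push_cast
  rw [sqrt_mul (by positivity)]
  field_simp

theorem eventually_exists_exact_partialSearch {K : ℕ} (hK : 1 ≤ K) {δ Δ : ℝ} (hδ : δ ≤ π / 2)
    (hΔ : 0 < Δ)
    (h : cos Δ * (sin δ / √(K : ℝ)) - sin Δ * cos δ + (K / 2 - 1) * (sin δ / √(K : ℝ)) < 0) :
    ∀ᶠ m : ℕ in atTop, ∃ A : PartialSearchAlgorithm K m,
      (A.queries : ℝ) ≤ π / 4 * (1 - 2 / π * (δ - Δ / √(K : ℝ))) * √((K * m : ℕ) : ℝ) ∧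
      A.SucceedsWithProb 1 := by
  have hsm : Tendsto (fun m : ℕ => √(m : ℝ)) atTop atTop :=
    tendsto_sqrt_atTop.comp tendsto_natCast_atTop_atTop
  filter_upwards [(tendsto_leakage hK hδ hΔ).eventually_lt_const h, eventually_ge_atTop 2,
    hsm.eventually_ge_atTop (2 / Δ)] with m hl hm hmΔ
  obtain ⟨η, θ, ω, ha, h0⟩ := exists_searchAngles_leakage_eq_zero hK hm _ _ hl.le
  obtain ⟨A, hq, hA⟩ := exists_exact_partialSearch hK (by omega) ha _ _ h0
  refine ⟨A, ?_, hA⟩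
  have hsK : 0 < √(K : ℝ) := by positivity
  have hN : √((K * m : ℕ) : ℝ) = √(K : ℝ) * √(m : ℝ) := by
    push_cast
    rw [sqrt_mul (by positivity)]
  have h1 : 1 ≤ ⌊Δ / 2 * √(m : ℝ)⌋₊ := by
    rw [Nat.one_le_floor_iff]
    rw [div_le_iff₀ hΔ] at hmΔ
    linarith
  have hj := Nat.floor_le (show 0 ≤ (π / 2 - δ) / 2 * √((K * m : ℕ) : ℝ) from
    mul_nonneg (by linarith) (sqrt_nonneg _))
  have hk := Nat.floor_le (show 0 ≤ Δ / 2 * √(m : ℝ) by positivity)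
  rw [hq, add_assoc, Nat.sub_add_cancel h1]
  push_cast at hj hk ⊢
  refine (add_le_add hj hk).trans (le_of_eq ?_)
  push_cast at hN
  rw [hN]
  field_simp
  ring

/-- With `δ = x / √K` global angle left over, the condition on the local angle `Δ` simplifies. -/
lemma exact_search_condition {K : ℕ} (hK : 1 ≤ K) {x Δ : ℝ} (hx : 0 ≤ x)
    (hδ : x / √(K : ℝ) ≤ π / 2) (h : x / 2 < sin Δ * cos (x / √(K : ℝ))) :
    cos Δ * (sin (x / √(K : ℝ)) / √(K : ℝ)) - sin Δ * cos (x / √(K : ℝ)) +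
      (K / 2 - 1) * (sin (x / √(K : ℝ)) / √(K : ℝ)) < 0 := by
  have hsK : 0 < √(K : ℝ) := by positivity
  have hKK : √(K : ℝ) * √(K : ℝ) = K := mul_self_sqrt (by positivity)
  have hδ0 : 0 ≤ x / √(K : ℝ) := by positivity
  have hs0 : 0 ≤ sin (x / √(K : ℝ)) := sin_nonneg_of_nonneg_of_le_pi hδ0 (by linarith [pi_pos])
  have h₁ : (K : ℝ) / 2 * (sin (x / √(K : ℝ)) / √(K : ℝ)) ≤ x / 2 := by
    calc (K : ℝ) / 2 * (sin (x / √(K : ℝ)) / √(K : ℝ)) ≤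
        (K : ℝ) / 2 * (x / √(K : ℝ) / √(K : ℝ)) := by gcongr; exact sin_le hδ0
      _ = x / 2 := by rw [div_div, hKK]; field_simp
  have h₂ : cos Δ * (sin (x / √(K : ℝ)) / √(K : ℝ)) ≤ 1 * (sin (x / √(K : ℝ)) / √(K : ℝ)) :=
    mul_le_mul_of_nonneg_right (cos_le_one Δ) (by positivity)
  linarith

/-- The saving `c` in the number of queries that exact partial search with `K` blocks allows. -/
theorem exists_saving {K : ℕ} (hK : 1 ≤ K) {x Δ : ℝ} (hx : 0 ≤ x) (hΔ : 0 < Δ)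
    (hδ : x / √(K : ℝ) ≤ π / 2) (h : x / 2 < sin Δ * cos (x / √(K : ℝ))) :
    ∀ᶠ m : ℕ in atTop, ∃ A : PartialSearchAlgorithm K m,
      (A.queries : ℝ) ≤ π / 4 * (1 - 2 / π * (x - Δ) / √(K : ℝ)) * √((K * m : ℕ) : ℝ) ∧
      A.SucceedsWithProb 1 := by
  have := eventually_exists_exact_partialSearch hK hδ hΔ (exact_search_condition hK hx hδ h)
  rwa [← sub_div, ← mul_div_assoc] at this

/-- The choice `x = 1/2`, `Δ = 3/8` works for every `K ≥ 1` and still has `x > Δ`, so the saving is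
positive. -/
lemma saving_condition_small {K : ℕ} (hK : 1 ≤ K) :
    (1 / 2 : ℝ) / √(K : ℝ) ≤ 1 / 2 ∧
      (1 / 2 : ℝ) / 2 < sin (3 / 8) * cos ((1 / 2 : ℝ) / √(K : ℝ)) := by
  have hs : 1 ≤ √(K : ℝ) := one_le_sqrt.2 (by exact_mod_cast hK)
  have h1 : (1 / 2 : ℝ) / √(K : ℝ) ≤ 1 / 2 := div_le_self (by norm_num) hs
  have h0 : 0 ≤ (1 / 2 : ℝ) / √(K : ℝ) := by positivity
  refine ⟨h1, ?_⟩
  have hsin : (0.36 : ℝ) ≤ sin (3 / 8) := by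
    have := sin_gt_sub_cube (show (0 : ℝ) < 3 / 8 by norm_num)
    norm_num at this ⊢
    linarith
  have hcos : (0.875 : ℝ) ≤ cos ((1 / 2 : ℝ) / √(K : ℝ)) := by
    have := one_sub_sq_div_two_le_cos (x := (1 / 2 : ℝ) / √(K : ℝ))
    nlinarith
  nlinarith

/-- At the optimal `Δ = π/3` the limiting constraint is `x < √3`; `1.72` lies just below. -/
lemma eventually_saving_condition_large :
    ∀ᶠ K : ℕ in atTop, (1.72 : ℝ) / √(K : ℝ) ≤ π / 2 ∧
      (1.72 : ℝ) / 2 < sin (π / 3) * cos ((1.72 : ℝ) / √(K : ℝ)) := by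
  have h0 : Tendsto (fun K : ℕ => (1.72 : ℝ) / √(K : ℝ)) atTop (nhds 0) :=
    tendsto_const_nhds.div_atTop (tendsto_sqrt_atTop.comp tendsto_natCast_atTop_atTop)
  have h1 : Tendsto (fun K : ℕ => sin (π / 3) * cos ((1.72 : ℝ) / √(K : ℝ))) atTop
      (nhds (sin (π / 3))) := by
    simpa using ((continuous_cos.tendsto 0).comp h0).const_mul (sin (π / 3))
  refine (h0.eventually_le_const (by positivity)).and (h1.eventually_const_lt ?_)
  rw [sin_pi_div_three]
  have : (1.72 : ℝ) < √3 := by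
    rw [lt_sqrt (by norm_num)]
    norm_num
  linarith

theorem exists_savings : ∃ c : ℕ → ℝ, (∀ K : ℕ, 1 ≤ K → 0 < c K) ∧
    (∀ᶠ K : ℕ in atTop, 0.42 / √(K : ℝ) ≤ c K) ∧
    ∀ K : ℕ, 1 ≤ K → ∀ᶠ m : ℕ in atTop, ∃ A : PartialSearchAlgorithm K m,
      (A.queries : ℝ) ≤ π / 4 * (1 - c K) * √((K * m : ℕ) : ℝ) ∧ A.SucceedsWithProb 1 := by
  classical
  obtain ⟨K₀, hK₀⟩ := eventually_atTop.1 eventually_saving_condition_large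
  have hπ := pi_lt_d2
  have hπ3 := pi_gt_three
  have hlarge : 0.42 ≤ 2 / π * (1.72 - π / 3) := by
    rw [div_mul_eq_mul_div, le_div_iff₀ pi_pos]
    linarith
  refine ⟨fun K => if K₀ ≤ K then 2 / π * (1.72 - π / 3) / √(K : ℝ) else
    2 / π * (1 / 2 - 3 / 8) / √(K : ℝ), fun K hK => ?_, ?_, fun K hK => ?_⟩
  · have hsK : 0 < √(K : ℝ) := by positivity
    dsimp only
    split_ifs
    · exact div_pos (by linarith) hsK
    · exact div_pos (mul_pos (by positivity) (by norm_num)) hsK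
  · filter_upwards [eventually_ge_atTop K₀] with K hK
    rw [if_pos hK]
    gcongr
  · dsimp only
    split_ifs with h
    · exact exists_saving hK (by norm_num) (by positivity) (hK₀ K h).1 (hK₀ K h).2
    · have := saving_condition_small hK
      exact exists_saving hK (by norm_num) (by norm_num) (this.1.trans (by linarith)) this.2

end Existence

theorem theorem1 :
    -- upper bound
    (∃ (c : ℕ → ℝ) (C : ℝ) (D : ℕ),
      (∀ K : ℕ, 1 ≤ K → 0 < c K) ∧
      (∀ᶠ K : ℕ in atTop, 0.42 / √(K : ℝ) ≤ c K) ∧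
      ∀ K : ℕ, 1 ≤ K → ∀ᶠ m : ℕ in atTop,
        ∃ A : PartialSearchAlgorithm K m,
          (A.queries : ℝ) ≤ π / 4 * (1 - c K) * √((K * m : ℕ) : ℝ) ∧
          A.SucceedsWithProb (1 - C * ((K * m : ℕ) : ℝ) ^ (-(1 / 2) : ℝ)) ∧
          ∃ A' : PartialSearchAlgorithm K m,
            A'.queries ≤ A.queries + D ∧ A'.SucceedsWithProb 1) ∧
    -- lower bound
    (∀ K : ℕ, 1 ≤ K → ∀ α C : ℝ,
      (∀ᶠ m : ℕ in atTop,
        ∃ A : PartialSearchAlgorithm K m,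
          (A.queries : ℝ) ≤ α * √((K * m : ℕ) : ℝ) ∧
          A.SucceedsWithProb (1 - C * ((K * m : ℕ) : ℝ) ^ (-(1 / 4) : ℝ))) →
      π / 4 * (1 - 1 / √(K : ℝ)) ≤ α) := by
  refine ⟨?_, fun K hK α C h => PartialSearchAlgorithm.lower_bound hK α C h⟩
  obtain ⟨c, hpos, hlarge, hc⟩ := exists_savings
  -- The algorithm is already exact, so it plays both roles with no error and no extra query.
  refine ⟨c, 0, 0, hpos, hlarge, fun K hK => ?_⟩
  filter_upwards [hc K hK] with m ⟨A, hq, hA⟩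
  exact ⟨A, hq, by simpa using hA, A, le_rfl, hA⟩
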